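/- Let $d\ge 3$ and let $A$ be any real number with $A>(2^{d+1}\,d!)^{1/(d-1)}$. An algebraic curve in $\mathbb R^d$ is a real algebraic set $C\subset\mathbb R^d$ (the set of common real zeros of some real polynomials, not necessarily irreducible or smooth) of dimension one. Its degree is the degree of the one-dimensional part of its Zariski closure in complex projective space; equivalently, it is the leading coefficient $n$ of its Hilbert polynomial $nm+c$, which for all large $m$ is the dimension of the space of functions on $C$ given by real polynomials of total degree at most $m$. The tangent vectors to $C$ at a point $a\in C$ are the limits of $c_j(x_j-a)$ with $x_j\in C$, $x_j\to a$, $c_j\in\mathbb R$ (so at a singular point, each branch of $C$ contributes its tangent line). Let $F_1,\dots,F_k$ be algebraic curves in $\mathbb R^d$ of degrees $n_1,\dots,n_k$, and put $n=\sum_i n_i$. A joint of the family is a point $a$ lying on at least $d$ of the curves such that the tangents at $a$ to the curves $F_i$ passing through $a$ are not all contained in a common hyperplane. Then the number of joints is finite and at most $A\,n^{d/(d-1)}$. The same constant $A$ serves for lines: for every set $L$ of $n$ lines in $\mathbb R^d$, the number of points that lie on at least $d$ lines of $L$, such that the lines of $L$ through the point are not all in a common hyperplane, is finite and at most $A\,n^{d/(d-1)}$.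 -/

import Mathlib

/-- An algebraic curve in `ℝ^d`: the set of common real zeros of some polynomials, of dimension one
(the dimension of an algebraic set is the Krull dimension of its coordinate ring). It need not be
irreducible or smooth. -/
def IsAlgebraicCurve {d : ℕ} (C : Set (Fin d → ℝ)) : Prop :=
  (∃ I : Ideal (MvPolynomial (Fin d) ℝ), C = MvPolynomial.zeroLocus ℝ I) ∧
    ringKrullDim (MvPolynomial (Fin d) ℝ ⧸ MvPolynomial.vanishingIdeal ℝ C) = 1

/-- The Hilbert function of a subset `C` of `ℝ^d`: the dimension of the space of functions on `C`
given by polynomials of total degree at most `m`, i.e. of the image of these polynomials in the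
coordinate ring of `C`. -/
noncomputable def hilbertFunction {d : ℕ} (C : Set (Fin d → ℝ)) (m : ℕ) : ℕ :=
  Module.finrank ℝ
    ((MvPolynomial.restrictTotalDegree (Fin d) ℝ m).map
      (Ideal.Quotient.mkₐ ℝ (MvPolynomial.vanishingIdeal ℝ C)).toLinearMap)

/-- The curve `C` has degree `n`: its Hilbert polynomial, which is linear for a curve, has leading
coefficient `n`. Equivalently, `n` is the degree of the one-dimensional part of the Zariski closure
of `C` in complex projective space. -/
def HasCurveDegree {d : ℕ} (C : Set (Fin d → ℝ)) (n : ℕ) : Prop :=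
  ∃ c : ℤ, ∀ᶠ m : ℕ in Filter.atTop, (hilbertFunction C m : ℤ) = (n : ℤ) * (m : ℤ) + c

/-- The joints of a family of curves: the points `a` on at least `d` of the curves such that the
tangents at `a` to the curves through `a` do not all lie in a common hyperplane. The tangent
vectors to `C i` at `a` are the limits of multiples of secant vectors from `a`; if several
branches of `C i` pass through `a`, each of them contributes its tangent line. -/
def curveJoints {d k : ℕ} (C : Fin k → Set (Fin d → ℝ)) : Set (Fin d → ℝ) :=
  {a | d ≤ {i | a ∈ C i}.ncard ∧
    ¬ ∃ H : Submodule ℝ (Fin d → ℝ), IsCoatom H ∧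
      ∀ i, a ∈ C i → tangentConeAt ℝ (C i) a ⊆ (H : Set (Fin d → ℝ))}

/-- The joints of a set of lines: the points `a` on at least `d` of the lines such that the lines
through `a` do not all lie in a common hyperplane. -/
def lineJoints {d : ℕ} (L : Finset (AffineSubspace ℝ (Fin d → ℝ))) : Set (Fin d → ℝ) :=
  {a | d ≤ {l | l ∈ L ∧ a ∈ l}.ncard ∧
    ¬ ∃ H : Submodule ℝ (Fin d → ℝ), IsCoatom H ∧ ∀ l ∈ L, a ∈ l → l.direction ≤ H}

/-!
The proof is the polynomial method combined with a Bézout inequality that is read off from Hilbert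
functions, so that neither dimension theory nor the degrees of the components are needed.

Each curve `C i` is the union of the zero loci of the finitely many minimal primes over its
vanishing ideal, its components. Let `S` be a finite set of joints, and let `k` be least such that
the polynomials of degree at most `k` form a space of dimension `(d + k).choose k` greater than
`S.card`; then `k ^ d ≤ d! * S.card`, and every subset of `S` lies on a hypersurface of degree at
most `k`. A nonzero polynomial `p` of least degree vanishing on `S` cannot vanish on all the
components: its gradient at a joint would be orthogonal to tangents that lie in no common
hyperplane, so the partial derivatives of `p`, of smaller degree, would vanish on `S`. Hence some
component is not contained in the zero set of `p`. Removing it together with the points of `S` on it and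
repeating (`exists_pruning`), one distributes all of `S` among the components, the part on each
component being cut out by a polynomial of degree at most `k` that does not vanish on it.

Write `h_J m` for the dimension of the polynomials of degree at most `m` modulo `J`. A simple exact
sequence (`idealHilbert_add_le`) gives two facts. If `N` points of the zero locus of a prime `P` are
zeros of some `p ∉ P` of degree at most `k`, then `h_P` grows by at least `N` when the degree grows
by `k` (`card_mul_le_idealHilbert`). And the sum of `h_P m` over the components of a curve is at
most the Hilbert function of the curve at `m + D` for a constant `D` (`exists_sum_idealHilbert_le`).
As the Hilbert function of a curve of degree `n` has slope `n`, the components of this curve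
received at most `n k` points in all (`sum_card_le_mul`). Summing over the curves, of total degree
`n`, gives `S.card ≤ n k`, hence `S.card ^ (d - 1) ≤ d! * n ^ d` (`card_pow_le_of_joints`), which
is the claim even with the smaller constant `(d!) ^ (1 / (d - 1))`. Since this bounds all finite
sets of joints, the number of joints is finite. Lines are the special case where the Hilbert
functions are at most `m + 1`.
-/

open MvPolynomial

section

/-! ### Hilbert functions of ideals -/

/-- The Hilbert function of `ℝ[X] / J`: the dimension of the image in the quotient of the
polynomials of total degree at most `m`. No vanishing condition is imposed on `J`. -/
noncomputable def idealHilbert {d : ℕ} (J : Ideal (MvPolynomial (Fin d) ℝ)) (m : ℕ) : ℕ :=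
  Module.finrank ℝ ((restrictTotalDegree (Fin d) ℝ m).map (Ideal.Quotient.mkₐ ℝ J).toLinearMap)

theorem Submodule.finrank_map_le_of_ker_le {K V W W' : Type*} [Field K] [AddCommGroup V]
    [Module K V] [AddCommGroup W] [Module K W] [AddCommGroup W'] [Module K W']
    (U : Submodule K V) [FiniteDimensional K U] (φ : V →ₗ[K] W) (ψ : V →ₗ[K] W')
    (h : LinearMap.ker φ ≤ LinearMap.ker ψ) :
    Module.finrank K (U.map ψ) ≤ Module.finrank K (U.map φ) := by
  have h1 := (φ.domRestrict U).finrank_range_add_finrank_ker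
  have h2 := (ψ.domRestrict U).finrank_range_add_finrank_ker
  rw [LinearMap.range_domRestrict] at h1 h2
  have h3 : LinearMap.ker (φ.domRestrict U) ≤ LinearMap.ker (ψ.domRestrict U) := by
    intro x hx
    exact h (show φ x = 0 from hx)
  have h4 := Submodule.finrank_mono h3
  omega

variable {d : ℕ}

theorem idealHilbert_mono (J : Ideal (MvPolynomial (Fin d) ℝ)) : Monotone (idealHilbert J) := by
  intro m m' h
  apply Submodule.finrank_mono
  apply Submodule.map_mono
  intro p hp
  rw [mem_restrictTotalDegree] at *
  omega

theorem idealHilbert_anti {J J' : Ideal (MvPolynomial (Fin d) ℝ)} (h : J' ≤ J) (m : ℕ) :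
    idealHilbert J m ≤ idealHilbert J' m := by
  apply Submodule.finrank_map_le_of_ker_le
  intro x hx
  simp only [LinearMap.mem_ker, AlgHom.toLinearMap_apply, Ideal.Quotient.mkₐ_eq_mk,
    Ideal.Quotient.eq_zero_iff_mem] at *
  exact h hx

/-- The basic inequality between Hilbert functions: `0 → J / J' → R / J' → R / J → 0` is exact, and
multiplication by `e ∈ J` embeds a quotient mapping onto `R / Q` into `J / J'`. -/
theorem idealHilbert_add_le {J J' Q : Ideal (MvPolynomial (Fin d) ℝ)} (hJ : J' ≤ J)
    {e : MvPolynomial (Fin d) ℝ} (he : e ∈ J) {k : ℕ} (hk : e.totalDegree ≤ k)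
    (hQ : ∀ f, e * f ∈ J' → f ∈ Q) (m : ℕ) :
    idealHilbert J (m + k) + idealHilbert Q m ≤ idealHilbert J' (m + k) := by
  set φ := (Ideal.Quotient.mkₐ ℝ J').toLinearMap
  set W := (restrictTotalDegree (Fin d) ℝ (m + k)).map φ with hW
  set g := (Ideal.Quotient.factorₐ ℝ hJ).toLinearMap
  set ψ := φ ∘ₗ LinearMap.mulLeft ℝ e
  have h1 := (g.domRestrict W).finrank_range_add_finrank_ker
  rw [LinearMap.range_domRestrict] at h1
  have h2 : W.map g =
      (restrictTotalDegree (Fin d) ℝ (m + k)).map (Ideal.Quotient.mkₐ ℝ J).toLinearMap := by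
    rw [hW, ← Submodule.map_comp]
    rfl
  have h3 : idealHilbert Q m ≤
      Module.finrank ℝ ((restrictTotalDegree (Fin d) ℝ m).map ψ) := by
    apply Submodule.finrank_map_le_of_ker_le
    intro f hf
    simp only [ψ, φ, LinearMap.mem_ker, LinearMap.comp_apply, LinearMap.mulLeft_apply,
      AlgHom.toLinearMap_apply, Ideal.Quotient.mkₐ_eq_mk, Ideal.Quotient.eq_zero_iff_mem] at *
    exact hQ f hf
  have h4 : (restrictTotalDegree (Fin d) ℝ m).map ψ ≤
      (LinearMap.ker (g.domRestrict W)).map W.subtype := by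
    rintro _ ⟨f, hf, rfl⟩
    refine ⟨⟨ψ f, ⟨e * f, ?_, rfl⟩⟩, ?_, rfl⟩
    · rw [SetLike.mem_coe, mem_restrictTotalDegree] at *
      exact (totalDegree_mul _ _).trans (by omega)
    · change Ideal.Quotient.mk J (e * f) = 0
      exact Ideal.Quotient.eq_zero_iff_mem.2 (J.mul_mem_right f he)
  have h5 := Submodule.finrank_mono h4
  rw [Submodule.finrank_map_subtype_eq] at h5
  rw [h2] at h1
  change Module.finrank ℝ _ + _ ≤ Module.finrank ℝ W
  omega

/-! ### Bézout inequalities -/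

/-- A product of affine linear forms separates `a` from the other points of `S`. -/
theorem exists_aeval_eq_one_and_eq_zero (S : Finset (Fin d → ℝ)) (a : Fin d → ℝ) :
    ∃ q : MvPolynomial (Fin d) ℝ, q.totalDegree ≤ S.card ∧ aeval a q = 1 ∧
      ∀ b ∈ S, b ≠ a → aeval b q = 0 := by
  classical
  have key : ∀ b, ∃ l : MvPolynomial (Fin d) ℝ, l.totalDegree ≤ 1 ∧ aeval a l = 1 ∧
      (b ≠ a → aeval b l = 0) := by
    intro b
    by_cases hb : b = a
    · exact ⟨1, by simp, by simp, fun h => absurd hb h⟩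
    · obtain ⟨i, hi⟩ := Function.ne_iff.1 hb
      refine ⟨C (a i - b i)⁻¹ * (X i - C (b i)), ?_, ?_, fun _ => by simp⟩
      · refine (totalDegree_mul _ _).trans ?_
        have := totalDegree_sub (X i) (C (b i) : MvPolynomial (Fin d) ℝ)
        simp at this ⊢
        exact this
      · have : a i - b i ≠ 0 := sub_ne_zero.2 (Ne.symm hi)
        simp [this]
  choose l hl1 hl2 hl3 using key
  refine ⟨∏ b ∈ S, l b, ?_, ?_, ?_⟩
  · refine (totalDegree_finsetProd _ _).trans ?_
    exact (Finset.sum_le_card_nsmul _ _ 1 fun b _ => hl1 b).trans (by simp)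
  · simp [map_prod, hl2]
  · intro b hb hba
    rw [map_prod]
    exact Finset.prod_eq_zero hb (hl3 b hba)

/-- Polynomials of degree at least the number of points of `S` interpolate every function on `S`. -/
theorem card_le_idealHilbert (S : Finset (Fin d → ℝ)) {m : ℕ} (hm : S.card ≤ m) :
    S.card ≤ idealHilbert (vanishingIdeal ℝ (S : Set (Fin d → ℝ))) m := by
  classical
  choose q hq1 hq2 hq3 using exists_aeval_eq_one_and_eq_zero S
  let φ : MvPolynomial (Fin d) ℝ →ₗ[ℝ] (S → ℝ) := LinearMap.pi fun a => (aeval a.1).toLinearMap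
  have h1 : (restrictTotalDegree (Fin d) ℝ m).map φ = ⊤ := by
    rw [eq_top_iff]
    intro f _
    refine ⟨∑ a : S, f a • q a, ?_, ?_⟩
    · exact Submodule.sum_mem _ fun a _ => Submodule.smul_mem _ _
        ((mem_restrictTotalDegree _ _ _).2 ((hq1 a).trans hm))
    · ext b
      simp only [φ, LinearMap.pi_apply, AlgHom.toLinearMap_apply, map_sum, map_smul]
      rw [Finset.sum_eq_single b]
      · simp [hq2]
      · intro a _ hab
        rw [hq3 a b b.2 (fun h => hab (Subtype.ext h.symm)), smul_zero]
      · simp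
  have h2 := Submodule.finrank_map_le_of_ker_le (restrictTotalDegree (Fin d) ℝ m)
    (Ideal.Quotient.mkₐ ℝ (vanishingIdeal ℝ (S : Set (Fin d → ℝ)))).toLinearMap φ (by
      intro p hp
      simp only [LinearMap.mem_ker, AlgHom.toLinearMap_apply, Ideal.Quotient.mkₐ_eq_mk,
        Ideal.Quotient.eq_zero_iff_mem] at *
      ext a
      exact hp a.1 a.2)
  rw [h1, finrank_top] at h2
  simpa [idealHilbert] using h2

/-- Bézout's theorem in the form needed: common zeros of `P` and of some `p ∉ P` of degree at most
`k` force the Hilbert function of `P` to grow by their number whenever the degree grows by `k`. -/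
theorem card_mul_le_idealHilbert {P : Ideal (MvPolynomial (Fin d) ℝ)} (hP : P.IsPrime)
    {p : MvPolynomial (Fin d) ℝ} (hp : p ∉ P) {k : ℕ} (hk : p.totalDegree ≤ k)
    (S : Finset (Fin d → ℝ)) (hS : ∀ a ∈ S, a ∈ zeroLocus ℝ P ∧ aeval a p = 0) (t : ℕ) :
    S.card * t ≤ idealHilbert P (S.card + t * k) := by
  induction t with
  | zero => simp
  | succ t ih =>
    have h1 := idealHilbert_add_le (J := vanishingIdeal ℝ (S : Set (Fin d → ℝ))) (J' := P) (Q := P)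
      (fun f hf a ha => (hS a ha).1 f hf) (fun a ha => (hS a ha).2) hk
      (fun f hf => (hP.mem_or_mem hf).resolve_left hp) (S.card + t * k)
    have h2 := card_le_idealHilbert S (m := S.card + t * k + k) (by omega)
    rw [mul_add, mul_one, add_mul, one_mul, ← add_assoc]
    omega

/-- The Hilbert functions of the components add up, up to a shift of the degree, to at most the
Hilbert function of the union. -/
theorem exists_sum_idealHilbert_le (T : Finset (Ideal (MvPolynomial (Fin d) ℝ)))
    (hprime : ∀ P ∈ T, P.IsPrime) (hanti : ∀ P ∈ T, ∀ Q ∈ T, Q ≤ P → Q = P) :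
    ∃ D, ∀ m, ∑ P ∈ T, idealHilbert P m ≤ idealHilbert (T.inf id) (m + D) := by
  classical
  induction T using Finset.induction_on with
  | empty => exact ⟨0, by simp⟩
  | insert P T hPT ih =>
    obtain ⟨D, hD⟩ := ih (fun Q hQ => hprime Q (Finset.mem_insert_of_mem hQ))
      (fun Q hQ Q' hQ' => hanti Q (Finset.mem_insert_of_mem hQ) Q' (Finset.mem_insert_of_mem hQ'))
    have hP := hprime P (Finset.mem_insert_self _ _)
    have hnot : ¬ T.inf id ≤ P := by
      intro h
      obtain ⟨Q, hQ, hQP⟩ := (Ideal.IsPrime.inf_le' hP).1 h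
      have := hanti P (Finset.mem_insert_self _ _) Q (Finset.mem_insert_of_mem hQ) hQP
      exact hPT (this ▸ hQ)
    obtain ⟨e, heT, heP⟩ := SetLike.not_le_iff_exists.1 hnot
    refine ⟨D + e.totalDegree, fun m => ?_⟩
    have h1 := idealHilbert_add_le (J := T.inf id) (J' := (insert P T).inf id) (Q := P)
      (by rw [Finset.inf_insert]; exact inf_le_right) heT le_rfl
      (fun f hf => by
        rw [Finset.inf_insert] at hf
        exact (hP.mem_or_mem hf.1).resolve_left heP) (m + D)
    rw [Finset.sum_insert hPT]
    have h2 := hD m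
    have h3 := idealHilbert_mono (T.inf id) (show m + D ≤ m + D + e.totalDegree by omega)
    have h4 := idealHilbert_mono P (show m ≤ m + D by omega)
    rw [← add_assoc]
    omega

/-- Bézout's theorem for a union of components: on a set whose Hilbert function is at most
`n m + c`, polynomials `p P` of degree at most `k`, none vanishing on its component `P`, have in
total at most `n k` zeros on their components. -/
theorem sum_card_le_mul (T : Finset (Ideal (MvPolynomial (Fin d) ℝ)))
    (hprime : ∀ P ∈ T, P.IsPrime) (hanti : ∀ P ∈ T, ∀ Q ∈ T, Q ≤ P → Q = P)
    {n : ℕ} {c : ℤ} (hT : ∀ᶠ m : ℕ in Filter.atTop, (idealHilbert (T.inf id) m : ℤ) ≤ n * m + c)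
    (k : ℕ) (p : Ideal (MvPolynomial (Fin d) ℝ) → MvPolynomial (Fin d) ℝ)
    (hp : ∀ P ∈ T, p P ∉ P) (hk : ∀ P ∈ T, (p P).totalDegree ≤ k)
    (S : Ideal (MvPolynomial (Fin d) ℝ) → Finset (Fin d → ℝ))
    (hS : ∀ P ∈ T, ∀ a ∈ S P, a ∈ zeroLocus ℝ P ∧ aeval a (p P) = 0) :
    ∑ P ∈ T, (S P).card ≤ n * k := by
  obtain ⟨D, hD⟩ := exists_sum_idealHilbert_le T hprime hanti
  obtain ⟨M, hM⟩ := Filter.eventually_atTop.1 hT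
  set N := ∑ P ∈ T, (S P).card with hN
  -- the estimate for one fixed shift `s` and all numbers `t` of Bézout steps
  set s := N + M
  have key : ∀ t : ℕ, (N : ℤ) * t ≤ n * k * t + (n * (s + D) + c) := by
    intro t
    have h1 : N * t ≤ ∑ P ∈ T, idealHilbert P (s + t * k) := by
      rw [hN, Finset.sum_mul]
      refine Finset.sum_le_sum fun P hP => ?_
      refine (card_mul_le_idealHilbert (hprime P hP) (hp P hP) (hk P hP) (S P) (hS P hP) t).trans ?_
      have : (S P).card ≤ N := Finset.single_le_sum (f := fun P => (S P).card) (by simp) hP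
      exact idealHilbert_mono P (by omega)
    have h2 := hM (s + t * k + D) (by omega)
    have h3 : ((N * t : ℕ) : ℤ) ≤ (idealHilbert (T.inf id) (s + t * k + D) : ℕ) := by
      exact_mod_cast h1.trans (hD _)
    push_cast at h2 h3
    linarith
  -- otherwise the left side outgrows the right one as `t` tends to infinity
  by_contra! h
  have h4 : (n * k + 1 : ℤ) ≤ N := by exact_mod_cast h
  have h5 := key (Int.toNat (n * (s + D) + c) + 1)
  have h6 := Int.self_le_toNat (n * (s + D) + c)
  push_cast at h5
  nlinarith

/-! ### Partial derivatives and joints -/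

theorem MvPolynomial.totalDegree_pderiv_lt {σ R : Type*} [CommSemiring R] {p : MvPolynomial σ R}
    (hp : 0 < p.totalDegree) (i : σ) : (pderiv i p).totalDegree < p.totalDegree := by
  rw [totalDegree, Finset.sup_lt_iff hp]
  intro s hs
  rw [mem_support_iff, coeff_pderiv] at hs
  have h1 := le_totalDegree (mem_support_iff.2 (left_ne_zero_of_mul hs))
  rw [Finsupp.sum_add_index' (fun _ => rfl) (fun _ _ _ => rfl),
    Finsupp.sum_single_index rfl] at h1
  exact h1

theorem MvPolynomial.exists_pderiv_ne_zero {σ : Type*} {p : MvPolynomial σ ℝ}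
    (hp : 0 < p.totalDegree) : ∃ i, pderiv i p ≠ 0 := by
  classical
  obtain ⟨s, hs, hsd⟩ : ∃ s ∈ p.support, 0 < s.sum fun _ e => e := by
    by_contra! h
    have : p.totalDegree ≤ 0 := Finset.sup_le fun s hs => h s hs
    omega
  obtain ⟨i, hi⟩ : ∃ i, s i ≠ 0 := by
    by_contra! h
    have : s = 0 := Finsupp.ext h
    simp [this] at hsd
  refine ⟨i, fun h => ?_⟩
  have h1 := coeff_pderiv (i := i) p (s - Finsupp.single i 1)
  have h2 : s - Finsupp.single i 1 + Finsupp.single i 1 = s :=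
    tsub_add_cancel_of_le (by
      rw [Finsupp.single_le_iff]; omega)
  rw [h, h2, coeff_zero] at h1
  have h3 : coeff s p ≠ 0 := mem_support_iff.1 hs
  have h4 : (((s - Finsupp.single i 1 : σ →₀ ℕ) i : ℝ) + 1) ≠ 0 := by positivity
  exact mul_ne_zero h3 h4 h1.symm

theorem MvPolynomial.hasFDerivAt_aeval {σ : Type*} [Fintype σ] (p : MvPolynomial σ ℝ) (x : σ → ℝ) :
    HasFDerivAt (fun y : σ → ℝ => aeval y p)
      (∑ i, aeval x (pderiv i p) • ContinuousLinearMap.proj (R := ℝ) (φ := fun _ : σ => ℝ) i) x := by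
  classical
  induction p using MvPolynomial.induction_on with
  | C a => simpa using hasFDerivAt_const a x
  | add p q hp hq =>
    convert! hp.add hq using 1
    · ext; simp
    · simp [add_smul, Finset.sum_add_distrib]
  | mul_X p j hp =>
    convert! hp.mul (hasFDerivAt_apply j x) using 1
    · ext; simp
    · ext v
      simp [pderiv_X, Pi.single_apply, add_mul, Finset.sum_add_distrib, Finset.mul_sum,
        apply_ite (eval x), mul_assoc]

/-- A polynomial vanishing on the components of the curves that pass through a joint is singular
there, as its derivative kills all tangents. Components not through `a` are irrelevant as they stay
away from a neighbourhood of `a`. -/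
theorem aeval_pderiv_eq_zero_of_joint {ι : Type*} {C : ι → Set (Fin d → ℝ)}
    {a : Fin d → ℝ}
    (ha : ¬ ∃ H : Submodule ℝ (Fin d → ℝ), IsCoatom H ∧
      ∀ i, a ∈ C i → tangentConeAt ℝ (C i) a ⊆ (H : Set (Fin d → ℝ)))
    {p : MvPolynomial (Fin d) ℝ}
    (hp : ∀ i, ∀ P ∈ (vanishingIdeal ℝ (C i)).minimalPrimes, a ∈ zeroLocus ℝ P → p ∈ P)
    (j : Fin d) : aeval a (pderiv j p) = 0 := by
  classical
  have hderiv := hasFDerivAt_aeval p a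
  set L : (Fin d → ℝ) →L[ℝ] ℝ :=
    ∑ i, aeval a (pderiv i p) • ContinuousLinearMap.proj (R := ℝ) (φ := fun _ : Fin d => ℝ) i
    with hL
  have hkill : ∀ i, a ∈ C i → tangentConeAt ℝ (C i) a ⊆ (LinearMap.ker L.toLinearMap : Set _) := by
    intro i hai v hv
    have hfin := Ideal.finite_minimalPrimes_of_isNoetherianRing _ (vanishingIdeal ℝ (C i))
    have hcl : ∀ P : Ideal (MvPolynomial (Fin d) ℝ), IsClosed (zeroLocus ℝ P) := by
      intro P
      have : zeroLocus ℝ P = ⋂ f ∈ P, {x : Fin d → ℝ | aeval x f = 0} := by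
        ext; simp
      rw [this]
      refine isClosed_biInter fun f _ => isClosed_eq ?_ continuous_const
      exact continuous_iff_continuousAt.2 fun x => (hasFDerivAt_aeval f x).continuousAt
    have hnear : ∀ᶠ x in nhds a, ∀ P ∈ (vanishingIdeal ℝ (C i)).minimalPrimes,
        a ∉ zeroLocus ℝ P → x ∉ zeroLocus ℝ P := by
      rw [Filter.eventually_all_finite hfin]
      intro P _
      by_cases h : a ∈ zeroLocus ℝ P
      · exact Filter.Eventually.of_forall fun x hx => absurd h hx
      · filter_upwards [(hcl P).isOpen_compl.mem_nhds h] with x hx _ using hx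
    have hzero : ∀ x ∈ C i, (∀ P ∈ (vanishingIdeal ℝ (C i)).minimalPrimes,
        a ∉ zeroLocus ℝ P → x ∉ zeroLocus ℝ P) → aeval x p = 0 := by
      intro x hx hxP
      obtain ⟨P, hP, hPx⟩ := Ideal.exists_minimalPrimes_le
        (vanishingIdeal_anti_mono (k := ℝ) (Set.singleton_subset_iff.2 hx))
      have hxz : x ∈ zeroLocus ℝ P := fun f hf => hPx hf x rfl
      exact hPx (hp i P hP (by_contra fun h => hxP P hP h hxz)) x rfl
    have h0 : HasFDerivWithinAt (fun y : Fin d → ℝ => aeval y p) (0 : (Fin d → ℝ) →L[ℝ] ℝ)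
        (C i) a := by
      refine (hasFDerivWithinAt_const (0 : ℝ) a (C i)).congr_of_eventuallyEq ?_
        (hzero a hai fun _ _ h => h)
      filter_upwards [nhdsWithin_le_nhds hnear, self_mem_nhdsWithin] with x hx hxC
      exact hzero x hxC hx
    exact hderiv.hasFDerivWithinAt.unique_on h0 hv
  have hL0 : L = 0 := by
    by_contra hne
    refine ha ⟨LinearMap.ker L.toLinearMap, ?_, hkill⟩
    refine LinearMap.isCoatom_ker_of_surjective (LinearMap.surjective ?_)
    exact fun h => hne (ContinuousLinearMap.coe_injective h)
  have := DFunLike.congr_fun hL0 (Pi.single j 1)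
  simpa [hL, Pi.single_apply] using this

/-! ### Distributing the joints among the components -/

/-- The pruning argument. If every subset of `S` is on a hypersurface of degree at most `k`, and a
polynomial vanishing on all components through a point of `S` is singular there, then `S` can be
distributed among the components so that the part on `P j` is cut out from it by a hypersurface of
degree at most `k` not containing `P j`. Indeed a polynomial of least degree vanishing on `S` cannot
vanish on all components, as its partial derivatives would then vanish on `S`; a component on which
it does not vanish is removed, with the points of `S` on it. -/
theorem exists_pruning {κ : Type*} [DecidableEq κ] (k : ℕ) (K : Finset κ)
    (P : κ → Ideal (MvPolynomial (Fin d) ℝ)) (hP : ∀ j ∈ K, P j ≠ ⊤) (S : Finset (Fin d → ℝ))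
    (hk : ∀ S' ⊆ S, ∃ p : MvPolynomial (Fin d) ℝ, p ≠ 0 ∧ p.totalDegree ≤ k ∧
      ∀ a ∈ S', aeval a p = 0)
    (hS : ∀ a ∈ S, ∀ p : MvPolynomial (Fin d) ℝ, (∀ j ∈ K, a ∈ zeroLocus ℝ (P j) → p ∈ P j) →
      ∀ i, aeval a (pderiv i p) = 0) :
    ∃ (s : κ → Finset (Fin d → ℝ)) (p : κ → MvPolynomial (Fin d) ℝ),
      (∀ j ∈ K, p j ∉ P j ∧ (p j).totalDegree ≤ k ∧
        ∀ a ∈ s j, a ∈ zeroLocus ℝ (P j) ∧ aeval a (p j) = 0) ∧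
      S ⊆ K.biUnion s := by
  classical
  induction K using Finset.strongInduction generalizing S with
  | H K ih =>
  obtain rfl | hne := S.eq_empty_or_nonempty
  · exact ⟨fun _ => ∅, fun _ => 1, fun j hj => ⟨fun h => hP j hj ((Ideal.eq_top_iff_one _).2 h),
      by simp, by simp⟩, by simp⟩
  have hex : ∃ n, ∃ p : MvPolynomial (Fin d) ℝ, p ≠ 0 ∧ p.totalDegree ≤ n ∧
      ∀ a ∈ S, aeval a p = 0 := ⟨k, hk S subset_rfl⟩
  obtain ⟨p, hp0, hpd, hpS⟩ := Nat.find_spec hex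
  have hpk : p.totalDegree ≤ k := hpd.trans (Nat.find_min' hex (hk S subset_rfl))
  have hmin : ∀ q : MvPolynomial (Fin d) ℝ, q ≠ 0 → (∀ a ∈ S, aeval a q = 0) →
      p.totalDegree ≤ q.totalDegree := fun q hq hqS =>
    hpd.trans (Nat.find_min' hex ⟨q, hq, le_rfl, hqS⟩)
  by_cases hall : ∀ j ∈ K, p ∈ P j
  · exfalso
    obtain ⟨a, ha⟩ := hne
    have hpos : 0 < p.totalDegree := by
      refine Nat.pos_of_ne_zero fun h => ?_
      have hC := totalDegree_eq_zero_iff_eq_C.1 h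
      have h1 := hpS a ha
      rw [hC, aeval_C] at h1
      have h2 : coeff 0 p = 0 := by simpa using h1
      rw [h2, C_0] at hC
      exact hp0 hC
    obtain ⟨i, hi⟩ := exists_pderiv_ne_zero hpos
    have h1 := hmin _ hi fun b hb => hS b hb p (fun j hj _ => hall j hj) i
    exact absurd (totalDegree_pderiv_lt hpos i) (not_lt.2 h1)
  · push Not at hall
    obtain ⟨j, hj, hpj⟩ := hall
    obtain ⟨s, q, hq, hcov⟩ := ih (K.erase j) (Finset.erase_ssubset hj)
      (fun i hi => hP i (Finset.mem_of_mem_erase hi)) (S.filter fun a => a ∉ zeroLocus ℝ (P j))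
      (fun S' hS' => hk S' (hS'.trans (Finset.filter_subset _ _)))
      (fun a ha f hf => by
        rw [Finset.mem_filter] at ha
        refine hS a ha.1 f fun i hi hai => ?_
        refine hf i (Finset.mem_erase.2 ⟨?_, hi⟩) hai
        rintro rfl
        exact ha.2 hai)
    refine ⟨Function.update s j (S.filter fun a => a ∈ zeroLocus ℝ (P j)),
      Function.update q j p, ?_, ?_⟩
    · intro i hi
      obtain rfl | hij := eq_or_ne i j
      · simp only [Function.update_self]
        refine ⟨hpj, hpk, fun a ha => ?_⟩
        rw [Finset.mem_filter] at ha
        exact ⟨ha.2, hpS a ha.1⟩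
      · simp only [Function.update_of_ne hij]
        exact hq i (Finset.mem_erase.2 ⟨hij, hi⟩)
    · intro a ha
      rw [Finset.mem_biUnion]
      by_cases haj : a ∈ zeroLocus ℝ (P j)
      · exact ⟨j, hj, by simpa [Function.update_self] using ⟨ha, haj⟩⟩
      · obtain ⟨i, hi, hai⟩ := Finset.mem_biUnion.1 (hcov (Finset.mem_filter.2 ⟨ha, haj⟩))
        refine ⟨i, Finset.mem_of_mem_erase hi, ?_⟩
        rwa [Function.update_of_ne (Finset.ne_of_mem_erase hi)]

/-! ### Hypersurfaces of small degree through given points -/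

theorem choose_le_finrank_restrictTotalDegree (d k : ℕ) :
    (d + k).choose k ≤ Module.finrank ℝ (restrictTotalDegree (Fin d) ℝ k) := by
  classical
  -- homogenization: the exponent of the extra variable `0` is determined by the others
  set T := (Finset.univ : Finset (Fin (d + 1))).finsuppAntidiag k
  have hT : ∀ s ∈ T, s 0 + ((s.tail).sum fun _ e => e) = k := by
    intro s hs
    rw [Finset.mem_finsuppAntidiag] at hs
    rw [← hs.1, Fin.sum_univ_succ, Finsupp.sum_fintype _ _ (fun _ => rfl)]
    rfl
  have hmem : ∀ s : T, (monomial s.1.tail (1 : ℝ)) ∈ restrictTotalDegree (Fin d) ℝ k := by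
    intro s
    rw [mem_restrictTotalDegree, totalDegree_monomial _ one_ne_zero]
    have := hT s.1 s.2
    omega
  have hinj : Function.Injective fun s : T => s.1.tail := by
    intro s t hst
    have h1 := hT s.1 s.2
    have h2 := hT t.1 t.2
    have hst' : s.1.tail = t.1.tail := hst
    rw [hst'] at h1
    apply Subtype.ext
    rw [← Finsupp.cons_tail s.1, ← Finsupp.cons_tail t.1, hst']
    congr 1
    omega
  have hli : LinearIndependent ℝ
      fun s : T => (⟨monomial s.1.tail 1, hmem s⟩ : restrictTotalDegree (Fin d) ℝ k) := by
    refine LinearIndependent.of_comp (Submodule.subtype _) ?_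
    have := (basisMonomials (Fin d) ℝ).linearIndependent.comp _ hinj
    simpa [Function.comp_def] using this
  have h := hli.fintype_card_le_finrank
  rw [Fintype.card_coe, Finset.card_finsuppAntidiag_nat_eq_choose, Finset.card_univ,
    Fintype.card_fin] at h
  convert h using 2
  omega

theorem exists_ne_zero_aeval_eq_zero {k : ℕ} (S : Finset (Fin d → ℝ))
    (hS : S.card < (d + k).choose k) :
    ∃ p : MvPolynomial (Fin d) ℝ, p ≠ 0 ∧ p.totalDegree ≤ k ∧ ∀ a ∈ S, aeval a p = 0 := by
  let φ : restrictTotalDegree (Fin d) ℝ k →ₗ[ℝ] (S → ℝ) :=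
    (LinearMap.pi fun a : S => (aeval a.1).toLinearMap).domRestrict _
  have h : LinearMap.ker φ ≠ ⊥ := φ.ker_ne_bot_of_finrank_lt (by
    simpa using hS.trans_le (choose_le_finrank_restrictTotalDegree d k))
  obtain ⟨p, hp, hp0⟩ := (Submodule.ne_bot_iff _).1 h
  refine ⟨p.1, fun h => hp0 (Subtype.ext h), (mem_restrictTotalDegree _ _ _).1 p.2, fun a ha => ?_⟩
  exact congr_fun (LinearMap.mem_ker.1 hp) ⟨a, ha⟩

/-- The least `k` with `N < (d + k).choose k` satisfies `k ^ d ≤ d! * N`. -/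
theorem exists_degree_bound (hd : d ≠ 0) (N : ℕ) :
    ∃ k, N < (d + k).choose k ∧ k ^ d ≤ d.factorial * N := by
  have hex : ∃ k, N < (d + k).choose k := by
    refine ⟨N, ?_⟩
    have h1 : (1 + N).choose N ≤ (d + N).choose N :=
      Nat.choose_le_choose _ (by omega)
    rw [add_comm 1 N, Nat.choose_succ_self_right] at h1
    omega
  refine ⟨Nat.find hex, Nat.find_spec hex, ?_⟩
  rcases hk : Nat.find hex with _ | k
  · simp [hd]
  · have h1 : (d + k).choose k ≤ N := not_lt.1 (Nat.find_min hex (by omega))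
    calc (k + 1) ^ d ≤ (k + 1).ascFactorial d := Nat.pow_succ_le_ascFactorial _ _
      _ = d.factorial * (k + d).choose d := Nat.ascFactorial_eq_factorial_mul_choose _ _
      _ = d.factorial * (d + k).choose k := by rw [add_comm k d, Nat.choose_symm_add]
      _ ≤ d.factorial * N := by gcongr

/-! ### The joints estimate -/

/-- The joints estimate for arbitrary subsets `C i` of `ℝ^d` whose Hilbert functions grow at most
linearly, with slope `n i`. -/
theorem card_pow_le_of_joints {ι : Type*} [Fintype ι] (hd : 2 ≤ d) (C : ι → Set (Fin d → ℝ))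
    (n : ι → ℕ)
    (hn : ∀ i, ∃ c : ℤ, ∀ᶠ m : ℕ in Filter.atTop, (hilbertFunction (C i) m : ℤ) ≤ n i * m + c)
    (S : Finset (Fin d → ℝ))
    (hS : ∀ a ∈ S, ¬ ∃ H : Submodule ℝ (Fin d → ℝ), IsCoatom H ∧
      ∀ i, a ∈ C i → tangentConeAt ℝ (C i) a ⊆ (H : Set (Fin d → ℝ))) :
    S.card ^ (d - 1) ≤ d.factorial * (∑ i, n i) ^ d := by
  classical
  have hfin : ∀ i, (vanishingIdeal ℝ (C i)).minimalPrimes.Finite := fun i =>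
    Ideal.finite_minimalPrimes_of_isNoetherianRing _ _
  set T : ι → Finset (Ideal (MvPolynomial (Fin d) ℝ)) := fun i => (hfin i).toFinset
  have hT : ∀ i P, P ∈ T i ↔ P ∈ (vanishingIdeal ℝ (C i)).minimalPrimes := fun i P =>
    (hfin i).mem_toFinset
  obtain ⟨k, hk1, hk2⟩ := exists_degree_bound (show d ≠ 0 by omega) S.card
  -- distribute the points among the pairs of a curve and one of its components
  obtain ⟨s, p, hsp, hcov⟩ := exists_pruning k (Finset.univ.sigma T) (fun j => j.2)
    (fun j hj => by
      have := (hT _ _).1 (Finset.mem_sigma.1 hj).2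
      exact this.1.1.ne_top) S
    (fun S' hS' => exists_ne_zero_aeval_eq_zero S' ((Finset.card_le_card hS').trans_lt hk1))
    (fun a ha p hp => aeval_pderiv_eq_zero_of_joint (hS a ha) fun i P hP =>
      hp ⟨i, P⟩ (Finset.mem_sigma.2 ⟨Finset.mem_univ _, (hT _ _).2 hP⟩))
  have hi : ∀ i, ∑ P ∈ T i, (s ⟨i, P⟩).card ≤ n i * k := by
    intro i
    obtain ⟨c, hc⟩ := hn i
    have hmem : ∀ P ∈ T i, (⟨i, P⟩ : Σ _ : ι, Ideal (MvPolynomial (Fin d) ℝ)) ∈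
        Finset.univ.sigma T := fun P hP => Finset.mem_sigma.2 ⟨Finset.mem_univ _, hP⟩
    refine sum_card_le_mul (T i) (fun P hP => ((hT _ _).1 hP).1.1)
      (fun P hP Q hQ hQP => le_antisymm hQP
        (((hT _ _).1 hP).2 ⟨((hT _ _).1 hQ).1.1, ((hT _ _).1 hQ).1.2⟩ hQP))
      (c := c) ?_ k (fun P => p ⟨i, P⟩) (fun P hP => (hsp _ (hmem P hP)).1)
      (fun P hP => (hsp _ (hmem P hP)).2.1) (fun P => s ⟨i, P⟩)
      (fun P hP => (hsp _ (hmem P hP)).2.2)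
    filter_upwards [hc] with m hm
    refine le_trans ?_ hm
    -- the vanishing ideal is in fact the intersection of its minimal primes; one inclusion suffices
    have hle : vanishingIdeal ℝ (C i) ≤ (T i).inf id :=
      Finset.le_inf fun P hP => ((hT _ _).1 hP).1.2
    exact_mod_cast idealHilbert_anti hle m
  have hcard : S.card ≤ (∑ i, n i) * k := by
    calc S.card ≤ ((Finset.univ.sigma T).biUnion s).card := Finset.card_le_card hcov
      _ ≤ ∑ j ∈ Finset.univ.sigma T, (s j).card := Finset.card_biUnion_le
      _ = ∑ i, ∑ P ∈ T i, (s ⟨i, P⟩).card := Finset.sum_sigma _ _ _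
      _ ≤ ∑ i, n i * k := Finset.sum_le_sum fun i _ => hi i
      _ = (∑ i, n i) * k := (Finset.sum_mul _ _ _).symm
  rcases Nat.eq_zero_or_pos S.card with h0 | hpos
  · rw [h0, zero_pow (by omega)]
    exact Nat.zero_le _
  · refine Nat.le_of_mul_le_mul_right ?_ hpos
    calc S.card ^ (d - 1) * S.card = S.card ^ d := by
          rw [← pow_succ, Nat.sub_add_cancel (by omega)]
      _ ≤ ((∑ i, n i) * k) ^ d := Nat.pow_le_pow_left hcard d
      _ = (∑ i, n i) ^ d * k ^ d := mul_pow _ _ _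
      _ ≤ (∑ i, n i) ^ d * (d.factorial * S.card) := Nat.mul_le_mul_left _ hk2
      _ = d.factorial * (∑ i, n i) ^ d * S.card := by ring

theorem le_mul_rpow_of_pow_le (hd : 3 ≤ d) {A : ℝ}
    (hA : ((2 : ℝ) ^ (d + 1) * (d.factorial : ℝ)) ^ (1 / ((d : ℝ) - 1)) < A) {N n : ℕ}
    (h : N ^ (d - 1) ≤ d.factorial * n ^ d) :
    (N : ℝ) ≤ A * (n : ℝ) ^ ((d : ℝ) / ((d : ℝ) - 1)) := by
  have hd1 : (0 : ℝ) < (d : ℝ) - 1 := by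
    have : (3 : ℝ) ≤ d := by exact_mod_cast hd
    linarith
  have hcast : ((d - 1 : ℕ) : ℝ) = (d : ℝ) - 1 := by
    rw [Nat.cast_sub (by omega), Nat.cast_one]
  have h1 : (N : ℝ) ^ ((d : ℝ) - 1) ≤ d.factorial * (n : ℝ) ^ (d : ℝ) := by
    rw [← hcast, Real.rpow_natCast, Real.rpow_natCast]
    exact_mod_cast h
  calc (N : ℝ) = ((N : ℝ) ^ ((d : ℝ) - 1)) ^ (1 / ((d : ℝ) - 1)) := by
        rw [← Real.rpow_mul (Nat.cast_nonneg _), mul_one_div_cancel hd1.ne', Real.rpow_one]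
    _ ≤ (d.factorial * (n : ℝ) ^ (d : ℝ)) ^ (1 / ((d : ℝ) - 1)) :=
        Real.rpow_le_rpow (by positivity) h1 (by positivity)
    _ = (d.factorial : ℝ) ^ (1 / ((d : ℝ) - 1)) * (n : ℝ) ^ ((d : ℝ) / ((d : ℝ) - 1)) := by
        rw [Real.mul_rpow (by positivity) (by positivity),
          ← Real.rpow_mul (Nat.cast_nonneg n), mul_one_div]
    _ ≤ A * (n : ℝ) ^ ((d : ℝ) / ((d : ℝ) - 1)) := by
        refine mul_le_mul_of_nonneg_right ?_ (by positivity)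
        -- the factor `2 ^ (d + 1)` of the constant is not needed
        refine le_trans (Real.rpow_le_rpow (by positivity) ?_ (by positivity)) hA.le
        exact le_mul_of_one_le_left (by positivity) (one_le_pow₀ one_le_two)

theorem Set.finite_and_ncard_le_of_forall_finset {α : Type*} {s : Set α} {B : ℝ}
    (h : ∀ t : Finset α, (t : Set α) ⊆ s → (t.card : ℝ) ≤ B) : s.Finite ∧ (s.ncard : ℝ) ≤ B := by
  have hfin : s.Finite := by
    by_contra hinf
    obtain ⟨t, ht, hcard⟩ := Set.Infinite.exists_subset_card_eq hinf (⌈B⌉₊ + 1)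
    have h1 := h t ht
    have h2 := Nat.le_ceil B
    rw [hcard] at h1
    push_cast at h1
    linarith
  refine ⟨hfin, ?_⟩
  rw [Set.ncard_eq_toFinset_card s hfin]
  exact h _ (by simp)

/-! ### Lines -/

/-- A polynomial of degree at most `m` restricts to a polynomial of degree at most `m` in the
parameter of a line. -/
theorem hilbertFunction_le_of_finrank_direction_eq_one {l : AffineSubspace ℝ (Fin d → ℝ)}
    (hl : Module.finrank ℝ l.direction = 1) (m : ℕ) :
    hilbertFunction (l : Set (Fin d → ℝ)) m ≤ m + 1 := by
  obtain ⟨v, hv⟩ := finrank_eq_one_iff'.1 hl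
  obtain hemp | ⟨b, hb⟩ := (l : Set (Fin d → ℝ)).eq_empty_or_nonempty
  · rw [AffineSubspace.coe_eq_bot_iff] at hemp
    rw [hemp, AffineSubspace.direction_bot, finrank_bot] at hl
    exact absurd hl zero_ne_one
  let r : MvPolynomial (Fin d) ℝ →ₐ[ℝ] Polynomial ℝ :=
    aeval fun i => Polynomial.C (b i) + Polynomial.C ((v : Fin d → ℝ) i) * Polynomial.X
  have hr : ∀ (p : MvPolynomial (Fin d) ℝ) (t : ℝ),
      (r p).eval t = aeval (b + t • (v : Fin d → ℝ)) p := by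
    intro p t
    have : ((Polynomial.aeval t).comp r) = aeval (b + t • (v : Fin d → ℝ)) := by
      refine MvPolynomial.algHom_ext fun i => ?_
      simp only [r, AlgHom.comp_apply, aeval_X, map_add, map_mul, Polynomial.aeval_C,
        Polynomial.aeval_X, Pi.add_apply, Pi.smul_apply, smul_eq_mul, Algebra.algebraMap_self,
        RingHom.id_apply]
      ring
    rw [← this]
    simp
  have hdeg : (restrictTotalDegree (Fin d) ℝ m).map r.toLinearMap ≤
      Polynomial.degreeLT ℝ (m + 1) := by
    rintro _ ⟨p, hp, rfl⟩
    rw [SetLike.mem_coe, mem_restrictTotalDegree] at hp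
    rw [Polynomial.mem_degreeLT, AlgHom.toLinearMap_apply]
    refine Polynomial.degree_lt_iff_coeff_zero _ (m + 1) |>.2 fun j hj => ?_
    refine Polynomial.coeff_eq_zero_of_natDegree_lt (lt_of_le_of_lt ?_ hj)
    refine (MvPolynomial.aeval_natDegree_le p hp _ (n := 1) fun i => ?_).trans (by simp)
    compute_degree
  have hfin : Module.Finite ℝ (Polynomial.degreeLT ℝ (m + 1)) :=
    Module.Finite.equiv (Polynomial.degreeLTEquiv ℝ (m + 1)).symm
  have hdim : Module.finrank ℝ (Polynomial.degreeLT ℝ (m + 1)) = m + 1 := by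
    rw [(Polynomial.degreeLTEquiv ℝ (m + 1)).finrank_eq, Module.finrank_fin_fun]
  have h1 := Submodule.finrank_map_le_of_ker_le (restrictTotalDegree (Fin d) ℝ m) r.toLinearMap
    (Ideal.Quotient.mkₐ ℝ (vanishingIdeal ℝ (l : Set (Fin d → ℝ)))).toLinearMap (by
      intro p hp
      simp only [LinearMap.mem_ker, AlgHom.toLinearMap_apply, Ideal.Quotient.mkₐ_eq_mk,
        Ideal.Quotient.eq_zero_iff_mem] at *
      intro x hx
      have hxl : x - b ∈ l.direction := AffineSubspace.vsub_mem_direction hx hb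
      obtain ⟨t, ht⟩ := hv.2 ⟨x - b, hxl⟩
      have ht' : t • (v : Fin d → ℝ) = x - b := congr_arg Subtype.val ht
      have := hr p t
      rw [hp, ht', add_sub_cancel, Polynomial.eval_zero] at this
      exact this.symm)
  exact h1.trans ((Submodule.finrank_mono hdeg).trans hdim.le)

theorem AffineSubspace.direction_subset_tangentConeAt {l : AffineSubspace ℝ (Fin d → ℝ)}
    {a : Fin d → ℝ} (ha : a ∈ l) :
    (l.direction : Set (Fin d → ℝ)) ⊆ tangentConeAt ℝ (l : Set (Fin d → ℝ)) a := by
  intro v hv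
  have h1 : v + a ∈ l := AffineSubspace.vadd_mem_of_mem_direction hv ha
  have h2 := mem_tangentConeAt_of_segment_subset (l.convex.segment_subset ha h1)
  rwa [add_sub_cancel_right] at h2

end

/-! ### The bound on the number of joints -/

theorem mainTheorem2 (d : ℕ) (hd : 3 ≤ d) (A : ℝ)
    (hA : ((2 : ℝ) ^ (d + 1) * (d.factorial : ℝ)) ^ (1 / ((d : ℝ) - 1)) < A) :
    (∀ L : Finset (AffineSubspace ℝ (Fin d → ℝ)),
      (∀ l ∈ L, Module.finrank ℝ l.direction = 1) →
        (lineJoints L).Finite ∧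
          ((lineJoints L).ncard : ℝ) ≤ A * (L.card : ℝ) ^ ((d : ℝ) / ((d : ℝ) - 1))) ∧
    (∀ (k : ℕ) (C : Fin k → Set (Fin d → ℝ)) (n : Fin k → ℕ),
      (∀ i, IsAlgebraicCurve (C i)) → (∀ i, HasCurveDegree (C i) (n i)) →
        (curveJoints C).Finite ∧
          ((curveJoints C).ncard : ℝ) ≤
            A * ((∑ i, n i : ℕ) : ℝ) ^ ((d : ℝ) / ((d : ℝ) - 1))) := by
  refine ⟨fun L hL => ?_, fun k C n _ hn => ?_⟩
  · refine Set.finite_and_ncard_le_of_forall_finset fun S hS => le_mul_rpow_of_pow_le hd hA ?_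
    have h := card_pow_le_of_joints (by omega) (fun l : L => (l.1 : Set (Fin d → ℝ))) (fun _ => 1)
      (fun l => ⟨1, Filter.Eventually.of_forall fun m => by
        have := hilbertFunction_le_of_finrank_direction_eq_one (hL l.1 l.2) m
        push_cast
        rw [one_mul]
        exact_mod_cast this⟩) S
      (fun a ha ⟨H, hH, hHL⟩ => (hS ha).2 ⟨H, hH, fun l hl hal =>
        (AffineSubspace.direction_subset_tangentConeAt hal).trans (hHL ⟨l, hl⟩ hal)⟩)
    simpa using h
  · refine Set.finite_and_ncard_le_of_forall_finset fun S hS => le_mul_rpow_of_pow_le hd hA ?_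
    refine card_pow_le_of_joints (by omega) C n (fun i => ?_) S fun a ha => (hS ha).2
    obtain ⟨c, hc⟩ := hn i
    exact ⟨c, hc.mono fun m hm => hm.le⟩
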